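/- Graphs are taken in the sense of Serre: a finite graph $Y$ consists of a finite set $V_Y$ of vertices, a finite set $\mathbf{E}_Y$ of directed edges, maps $o,t:\mathbf{E}_Y\to V_Y$ (origin and terminus) and a fixed-point-free involution $\varepsilon\mapsto\bar\varepsilon$ of $\mathbf{E}_Y$ with $o(\bar\varepsilon)=t(\varepsilon)$ (loops and multiple edges are allowed). Let $C_0(Y)=\mathbb{C}V_Y$, let $C_1(Y)$ be the quotient of $\mathbb{C}\mathbf{E}_Y$ by the span of all $\varepsilon+\bar\varepsilon$, let $\chi(Y)=\dim_{\mathbb{C}} C_0(Y)-\dim_{\mathbb{C}} C_1(Y)$, and let $\kappa(Y)$ be the number of spanning trees of $Y$. Let a finite abelian group $G$ act on $Y$ by graph automorphisms, so that $C_0(Y)$ is a finitely generated projective $\mathbb{C}[G]$-module, and let $\mathcal{A}$ and $\mathcal{D}$ be the $\mathbb{C}[G]$-endomorphisms of $C_0(Y)$ with $\mathcal{A}(w)=\sum_{o(\varepsilon)=w}t(\varepsilon)$ and $\mathcal{D}(w)=|\{\varepsilon:o(\varepsilon)=w\}|\cdot w$ for $w\in V_Y$. Let $$\eta_Y(u)=\det{}_{\mathbb{C}[G][u]}\bigl(\mathcal{I}-\mathcal{A}u+(\mathcal{D}-\mathcal{I})u^2\bigr)\in\mathbb{C}[G][u]$$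 be the determinant of the operator displayed on the finitely generated projective $\mathbb{C}[G][u]$-module $C_0(Y)[u]$ (if $M\oplus N$ is free of finite rank, the determinant of an endomorphism $f$ of $M$ is that of $f\oplus\mathrm{id}_N$). For a character $\psi\in\widehat G=\mathrm{Hom}(G,\mathbb{C}^\times)$, let $h(u,\psi)\in\mathbb{C}[u]$ be the polynomial obtained from $\eta_Y(u)$ by applying to its coefficients the $\mathbb{C}$-algebra morphism $\mathbb{C}[G]\to\mathbb{C}$ which extends $\psi$. Let $\psi_0$ be the trivial character. Theorem. Let $Y$ be a finite connected graph on which a finite abelian group $G$ acts without inversion (that is, $\sigma\varepsilon\neq\bar\varepsilon$ for all $\sigma\in G$ and $\varepsilon\in\mathbf{E}_Y$) and freely on directed edges. If $\chi(Y)\neq 0$, then $$\mathrm{ord}_{u=1}h(u,\psi)=0\ \text{ for every nontrivial }\psi\in\widehat G,\qquad \mathrm{ord}_{u=1}h(u,\psi_0)=1,$$ and $$-2\,\chi(Y)\,\kappa(Y)=h'(1,\psi_0)\prod_{\psi\neq\psi_0}h(1,\psi),$$ where $h'$ denotes the derivative with respect to $u$. -/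

import Mathlib

open scoped TensorProduct Polynomial

/-- A graph in the sense of Serre: vertices `V`, directed edges `E`, origin and terminus maps, and a
fixed-point-free involution on directed edges which exchanges origin and terminus. Loops and
multiple edges are allowed. An undirected edge is a pair `{e, inv e}`. -/
structure SerreGraph (V E : Type*) where
  o : E → V
  t : E → V
  inv : E → E
  inv_inv : ∀ e, inv (inv e) = e
  inv_ne : ∀ e, inv e ≠ e
  o_inv : ∀ e, o (inv e) = t e
  t_inv : ∀ e, t (inv e) = o e

namespace SerreGraph

variable {V E : Type*}

/-- There is a path from `v` to `w` all of whose directed edges lie in `S`. -/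
def Joined (Y : SerreGraph V E) (S : Set E) (v w : V) : Prop :=
  Relation.ReflTransGen (fun a b => ∃ e ∈ S, Y.o e = a ∧ Y.t e = b) v w

/-- There is a path between any two vertices. -/
def Connected (Y : SerreGraph V E) : Prop :=
  ∀ v w, Y.Joined Set.univ v w

/-- A circuit of length `n + 1`: a closed path `c 0, …, c n` (indices are taken modulo `n + 1`)
which passes through no vertex twice and has no backtracking. -/
structure IsCircuit (Y : SerreGraph V E) {n : ℕ} (c : Fin (n + 1) → E) : Prop where
  closed : ∀ i, Y.t (c i) = Y.o (c (i + 1))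
  no_backtrack : ∀ i, c (i + 1) ≠ Y.inv (c i)
  injective : Function.Injective fun i => Y.o (c i)

/-- The subgraph with all the vertices of `Y` and with set of directed edges `S` is a tree, that is
a connected graph without circuits. -/
structure IsSpanningTree (Y : SerreGraph V E) (S : Set E) : Prop where
  inv_mem : ∀ e ∈ S, Y.inv e ∈ S
  connected : ∀ v w, Y.Joined S v w
  acyclic : ∀ (n : ℕ) (c : Fin (n + 1) → E), (∀ i, c i ∈ S) → ¬ Y.IsCircuit c

/-- The number `κ(Y)` of spanning trees. -/
noncomputable def numSpanningTrees (Y : SerreGraph V E) : ℕ :=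
  {S : Set E | Y.IsSpanningTree S}.ncard

/-- The subspace `W` of `ℂE` spanned by the elements `e + inv e`. -/
noncomputable def invSubspace (Y : SerreGraph V E) : Submodule ℂ (E →₀ ℂ) :=
  Submodule.span ℂ
    (Set.range fun e : E => Finsupp.single e (1 : ℂ) + Finsupp.single (Y.inv e) (1 : ℂ))

/-- The Euler characteristic `χ(Y) = dim C₀(Y) - dim C₁(Y)`, where `C₀(Y) = ℂV` and
`C₁(Y) = ℂE / W`. -/
noncomputable def eulerChar (Y : SerreGraph V E) : ℤ :=
  (Module.finrank ℂ (V →₀ ℂ) : ℤ) - (Module.finrank ℂ ((E →₀ ℂ) ⧸ Y.invSubspace) : ℤ)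

/-- The actions of `G` on `V` and on `E` are compatible with the graph structure: `G` acts on the
graph `Y` by automorphisms. -/
class IsAction (G : Type*) [Group G] [MulAction G V] [MulAction G E]
    (Y : SerreGraph V E) : Prop where
  o_smul : ∀ (σ : G) (e : E), Y.o (σ • e) = σ • Y.o e
  t_smul : ∀ (σ : G) (e : E), Y.t (σ • e) = σ • Y.t e
  inv_smul : ∀ (σ : G) (e : E), Y.inv (σ • e) = σ • Y.inv e

/-- The action of `G` on `Y` is without inversion. -/
def WithoutInversion (G : Type*) [Group G] [MulAction G E] (Y : SerreGraph V E) : Prop :=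
  ∀ (σ : G) (e : E), σ • e ≠ Y.inv e

/-- `G` acts freely on the directed edges of `Y`. -/
def FreeOnEdges (G : Type*) [Group G] [MulAction G E] (_Y : SerreGraph V E) : Prop :=
  ∀ (σ : G) (e : E), σ • e = e → σ = 1

section Operators

variable [Fintype E]

open Classical in
/-- The set of directed edges with origin `w`. -/
noncomputable def edgesFrom (Y : SerreGraph V E) (w : V) : Finset E :=
  Finset.univ.filter fun e => Y.o e = w

/-- The degree operator `w ↦ val(w) • w` on `ℂV`. -/
noncomputable def degreeOp (Y : SerreGraph V E) : (V →₀ ℂ) →ₗ[ℂ] (V →₀ ℂ) :=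
  Finsupp.linearCombination ℂ fun w => Finsupp.single w ((Y.edgesFrom w).card : ℂ)

/-- The adjacency operator `w ↦ ∑ t(e)`, the sum over the directed edges `e` with origin `w`. -/
noncomputable def adjacencyOp (Y : SerreGraph V E) : (V →₀ ℂ) →ₗ[ℂ] (V →₀ ℂ) :=
  Finsupp.linearCombination ℂ fun w => ∑ e ∈ Y.edgesFrom w, Finsupp.single (Y.t e) (1 : ℂ)

end Operators

end SerreGraph

section ProjectiveDeterminant

variable {R M : Type*} [CommRing R] [AddCommGroup M] [Module R M]

/-- The determinant of an endomorphism `f` of a finitely generated projective module `M` over a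
commutative ring. Choose `p : Rⁿ → M` and `i : M → Rⁿ` with `p ∘ i = id`, so that
`Rⁿ = i(M) ⊕ ker p`, and take the determinant of the endomorphism of `Rⁿ` which is `f` on `i(M)`
and the identity on `ker p`. It does not depend on the choices, see `projDet_eq`. -/
noncomputable def projDet [Module.Finite R M] [Module.Projective R M] (f : M →ₗ[R] M) : R :=
  let h := Module.Finite.exists_comp_eq_id_of_projective R M
  let p := h.choose_spec.choose
  let i := h.choose_spec.choose_spec.choose
  LinearMap.det (i ∘ₗ f ∘ₗ p + (LinearMap.id - i ∘ₗ p))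

theorem det_split_eq {m n : ℕ} (f : M →ₗ[R] M)
    (p : (Fin n → R) →ₗ[R] M) (i : M →ₗ[R] (Fin n → R)) (h : p ∘ₗ i = LinearMap.id)
    (q : (Fin m → R) →ₗ[R] M) (j : M →ₗ[R] (Fin m → R)) (k : q ∘ₗ j = LinearMap.id) :
    LinearMap.det (i ∘ₗ f ∘ₗ p + (LinearMap.id - i ∘ₗ p)) =
      LinearMap.det (j ∘ₗ f ∘ₗ q + (LinearMap.id - j ∘ₗ q)) := by
  have hp : ∀ x, p (i x) = x := fun x => LinearMap.congr_fun h x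
  have hq : ∀ x, q (j x) = x := fun x => LinearMap.congr_fun k x
  have e1 : i ∘ₗ f ∘ₗ p + (LinearMap.id - i ∘ₗ p) =
      LinearMap.id + (i ∘ₗ (f - LinearMap.id) ∘ₗ q) ∘ₗ (j ∘ₗ p) := by
    refine LinearMap.ext fun x => ?_
    simp [hq]
    abel
  have e2 : j ∘ₗ f ∘ₗ q + (LinearMap.id - j ∘ₗ q) =
      LinearMap.id + (j ∘ₗ p) ∘ₗ (i ∘ₗ (f - LinearMap.id) ∘ₗ q) := by
    refine LinearMap.ext fun x => ?_
    simp [hp]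
    abel
  rw [e1, e2, ← LinearMap.det_toMatrix', ← LinearMap.det_toMatrix', map_add, map_add,
    LinearMap.toMatrix'_comp, LinearMap.toMatrix'_comp, LinearMap.toMatrix'_id,
    LinearMap.toMatrix'_id, Matrix.det_one_add_mul_comm]

/-- If `M ⊕ N` is free of finite rank, then the determinant of `f` is that of `f ⊕ id`. -/
theorem projDet_eq [Module.Finite R M] [Module.Projective R M] (f : M →ₗ[R] M)
    {N : Type*} [AddCommGroup N] [Module R N] {n : ℕ} (e : (M × N) ≃ₗ[R] (Fin n → R)) :
    projDet f = LinearMap.det (f.prodMap (LinearMap.id : N →ₗ[R] N)) := by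
  have h := Module.Finite.exists_comp_eq_id_of_projective R M
  unfold projDet
  rw [det_split_eq f _ _ h.choose_spec.choose_spec.choose_spec.2.2
    (LinearMap.fst R M N ∘ₗ e.symm.toLinearMap) (e.toLinearMap ∘ₗ LinearMap.inl R M N)
    (by ext x; simp), ← LinearMap.det_conj _ e]
  congr 1
  refine LinearMap.ext fun x => ?_
  obtain ⟨y, rfl⟩ := e.surjective x
  simp only [LinearMap.add_apply, LinearMap.sub_apply, LinearMap.comp_apply, LinearMap.id_apply,
    LinearEquiv.coe_coe, LinearEquiv.symm_apply_apply]
  rw [← map_sub, ← map_add]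
  congr 1
  ext <;> simp

/-- For endomorphisms `A` and `D` of an `R`-module `M`, the operator `I - A u + (D - I) u²` on the
`R[u]`-module `M[u]`, which is obtained from `M` by extension of scalars from `R` to `R[u]`. -/
noncomputable def threeTermOp (A D : M →ₗ[R] M) : (R[X] ⊗[R] M) →ₗ[R[X]] (R[X] ⊗[R] M) :=
  LinearMap.id - (Polynomial.X : R[X]) • A.baseChange R[X]
    + (Polynomial.X ^ 2 : R[X]) • (D - LinearMap.id).baseChange R[X]

end ProjectiveDeterminant

namespace SerreGraph

variable {V E : Type*} (G : Type*)

/-- The permutation representation of `G` on `ℂV`. -/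
noncomputable def vertexRep (V : Type*) [Group G] [MulAction G V] :
    Representation ℂ G (V →₀ ℂ) where
  toFun σ := Finsupp.lmapDomain ℂ ℂ (σ • ·)
  map_one' := by ext; simp
  map_mul' σ τ := by ext; simp [mul_smul]

/-- `C₀(Y) = ℂV`, considered as a module over the group algebra `ℂ[G]`. -/
@[nolint unusedArguments]
def C0 (_G V : Type*) : Type _ := V →₀ ℂ

noncomputable instance (V : Type*) : AddCommGroup (C0 G V) :=
  inferInstanceAs (AddCommGroup (V →₀ ℂ))

noncomputable instance (V : Type*) : Module ℂ (C0 G V) :=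
  inferInstanceAs (Module ℂ (V →₀ ℂ))

/-- The identity map from `C₀(Y)` to `ℂV`. -/
noncomputable def C0.equiv (V : Type*) : C0 G V ≃ₗ[ℂ] (V →₀ ℂ) :=
  LinearEquiv.refl ℂ (V →₀ ℂ)

/-- A group ring element `∑ a_σ σ` acts on `ℂV` as `∑ a_σ ρ(σ)`, where `ρ` is the permutation
representation. -/
noncomputable instance (V : Type*) [Group G] [MulAction G V] :
    Module (MonoidAlgebra ℂ G) (C0 G V) where
  smul a x := (C0.equiv G V).symm ((vertexRep G V).asAlgebraHom a (C0.equiv G V x))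
  one_smul x := by
    change (C0.equiv G V).symm ((vertexRep G V).asAlgebraHom 1 (C0.equiv G V x)) = x
    simp
  mul_smul a b x := by
    change (C0.equiv G V).symm ((vertexRep G V).asAlgebraHom (a * b) (C0.equiv G V x)) =
      (C0.equiv G V).symm ((vertexRep G V).asAlgebraHom a (C0.equiv G V
        ((C0.equiv G V).symm ((vertexRep G V).asAlgebraHom b (C0.equiv G V x)))))
    simp
  smul_zero a := by
    change (C0.equiv G V).symm ((vertexRep G V).asAlgebraHom a (C0.equiv G V 0)) = 0
    simp
  smul_add a x y := by
    change (C0.equiv G V).symm ((vertexRep G V).asAlgebraHom a (C0.equiv G V (x + y))) =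
      (C0.equiv G V).symm ((vertexRep G V).asAlgebraHom a (C0.equiv G V x)) +
        (C0.equiv G V).symm ((vertexRep G V).asAlgebraHom a (C0.equiv G V y))
    simp
  add_smul a b x := by
    change (C0.equiv G V).symm ((vertexRep G V).asAlgebraHom (a + b) (C0.equiv G V x)) =
      (C0.equiv G V).symm ((vertexRep G V).asAlgebraHom a (C0.equiv G V x)) +
        (C0.equiv G V).symm ((vertexRep G V).asAlgebraHom b (C0.equiv G V x))
    simp
  zero_smul x := by
    change (C0.equiv G V).symm ((vertexRep G V).asAlgebraHom 0 (C0.equiv G V x)) = 0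
    simp

section ModuleInstances

variable (V : Type*) [Group G] [MulAction G V]

theorem C0.equiv_smul (a : MonoidAlgebra ℂ G) (x : C0 G V) :
    C0.equiv G V (a • x) = (vertexRep G V).asAlgebraHom a (C0.equiv G V x) := rfl

instance : IsScalarTower ℂ (MonoidAlgebra ℂ G) (C0 G V) where
  smul_assoc r a x := (C0.equiv G V).injective (by simp [C0.equiv_smul])

instance [Finite V] : Module.Finite (MonoidAlgebra ℂ G) (C0 G V) := by
  have : Module.Finite ℂ (C0 G V) := Module.Finite.equiv (C0.equiv G V).symm
  exact Module.Finite.of_restrictScalars_finite ℂ _ _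

instance [Finite G] : Module.Projective (MonoidAlgebra ℂ G) (C0 G V) :=
  Module.projective_of_isSemisimpleRing _ _

end ModuleInstances

section Equivariant

variable [Fintype E] [Group G] [MulAction G V] [MulAction G E]

variable {G} in
theorem sum_edgesFrom_smul (Y : SerreGraph V E) [Y.IsAction G] {A : Type*} [AddCommMonoid A]
    (σ : G) (w : V) (F : E → A) :
    ∑ e ∈ Y.edgesFrom (σ • w), F e = ∑ e ∈ Y.edgesFrom w, F (σ • e) := by
  classical
  symm
  refine Finset.sum_bij (fun e _ => σ • e) ?_ ?_ ?_ ?_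
  · intro e he
    simpa [edgesFrom, IsAction.o_smul] using he
  · intro a _ b _ hab
    exact smul_left_cancel σ hab
  · intro e he
    refine ⟨σ⁻¹ • e, ?_, by simp⟩
    have : Y.o e = σ • w := by simpa [edgesFrom] using he
    simp [edgesFrom, IsAction.o_smul, this]
  · intro e _
    rfl

theorem degreeOp_equivariant (Y : SerreGraph V E) [Y.IsAction G] (σ : G) (x : V →₀ ℂ) :
    Y.degreeOp (vertexRep G V σ x) = vertexRep G V σ (Y.degreeOp x) := by
  induction x using Finsupp.induction_linear with
  | zero => simp
  | add x y hx hy => simp only [map_add, hx, hy]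
  | single w a =>
    have hc : (Y.edgesFrom (σ • w)).card = (Y.edgesFrom w).card := by
      rw [Finset.card_eq_sum_ones, sum_edgesFrom_smul, ← Finset.card_eq_sum_ones]
    simp only [vertexRep, degreeOp, MonoidHom.coe_mk, OneHom.coe_mk, Finsupp.lmapDomain_apply,
      Finsupp.mapDomain_single, Finsupp.linearCombination_single, Finsupp.smul_single, hc]

theorem adjacencyOp_equivariant (Y : SerreGraph V E) [Y.IsAction G] (σ : G) (x : V →₀ ℂ) :
    Y.adjacencyOp (vertexRep G V σ x) = vertexRep G V σ (Y.adjacencyOp x) := by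
  induction x using Finsupp.induction_linear with
  | zero => simp
  | add x y hx hy => simp only [map_add, hx, hy]
  | single w a =>
    simp [vertexRep, adjacencyOp, Finsupp.mapDomain_single, sum_edgesFrom_smul, IsAction.t_smul]

/-- The degree operator as a morphism of `ℂ[G]`-modules. -/
noncomputable def degreeHom (Y : SerreGraph V E) [Y.IsAction G] :
    C0 G V →ₗ[MonoidAlgebra ℂ G] C0 G V :=
  MonoidAlgebra.equivariantOfLinearOfComm
    ((C0.equiv G V).symm.toLinearMap ∘ₗ Y.degreeOp ∘ₗ
      (C0.equiv G V).toLinearMap)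
    (fun σ x => (C0.equiv G V).injective (by
      simp [C0.equiv_smul, degreeOp_equivariant]))

/-- The adjacency operator as a morphism of `ℂ[G]`-modules. -/
noncomputable def adjacencyHom (Y : SerreGraph V E) [Y.IsAction G] :
    C0 G V →ₗ[MonoidAlgebra ℂ G] C0 G V :=
  MonoidAlgebra.equivariantOfLinearOfComm
    ((C0.equiv G V).symm.toLinearMap ∘ₗ Y.adjacencyOp ∘ₗ
      (C0.equiv G V).toLinearMap)
    (fun σ x => (C0.equiv G V).injective (by
      simp [C0.equiv_smul, adjacencyOp_equivariant]))

end Equivariant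

section Ihara

variable [Fintype E] [CommGroup G] [MulAction G V] [MulAction G E]

/-- The equivariant polynomial `η_Y(u)`: the determinant over `ℂ[G][u]` of the operator
`Δ(u) = I - A u + (D - I) u²` on `C₀(Y)[u]`. -/
noncomputable def eta [Finite V] [Finite G] (Y : SerreGraph V E) [Y.IsAction G] :
    (MonoidAlgebra ℂ G)[X] :=
  projDet (threeTermOp (Y.adjacencyHom G) (Y.degreeHom G))

variable {G} in
/-- The polynomial `h(u, ψ)`: apply to the coefficients of `η_Y(u)` the `ℂ`-algebra morphism
`ℂ[G] → ℂ` which extends the character `ψ`. -/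
noncomputable def h [Finite V] [Finite G] (Y : SerreGraph V E) [Y.IsAction G] (ψ : G →* ℂˣ) :
    ℂ[X] :=
  (Y.eta G).map (MonoidAlgebra.lift ℂ ℂ G ((Units.coeHom ℂ).comp ψ)).toRingHom

/-- The finite set of the nontrivial characters of `G`. -/
noncomputable def nontrivialCharacters [Finite G] : Finset (G →* ℂˣ) :=
  (Set.toFinite {ψ : G →* ℂˣ | ψ ≠ 1}).toFinset

end Ihara

end SerreGraph

/-! Since `ℂ[G]` is the product of its characters, the norm of an element to `ℂ` is the product of
its character values. The norm of a determinant over `ℂ[G]` is the determinant over `ℂ`, so the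
product of all `h(u, ψ)` is the ordinary Ihara polynomial `det(I - Au + (D - I)u²)` on `ℂV`
(`prod_h`).

At `u = 1` the operator is the Laplacian `L = D - A`, which is singular, and the derivative of the
operator is `L + (D - 2)`. Differentiating the determinant row by row leaves, for each vertex `v`,
the number `deg v - 2` times the minor of `L` at `v`. By the matrix tree theorem this minor is `κ`,
so the derivative at `1` is `(|E| - 2|V|)κ = -2χκ` (`eval_derivative_iharaPolynomial`).

The image of `L` has augmentation `0`, so the factor of the trivial character vanishes at `1`
(`eval_h_one_one`). The product rule then reduces to the stated formula. Its left side is nonzero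
because `χ ≠ 0` and a connected graph has a spanning tree, so no factor on the right vanishes, and
this gives both orders of vanishing. -/

namespace SerreGraph

/-! ### Paths, circuits and minimality of spanning trees -/

variable {V E : Type*} (Y : SerreGraph V E)

/-- There is a path of length `n` from `a` to `b` with directed edges in `S`. -/
def HasPath (S : Set E) (n : ℕ) (a b : V) : Prop :=
  ∃ w : ℕ → V, w 0 = a ∧ w n = b ∧ ∀ i < n, ∃ e ∈ S, Y.o e = w i ∧ Y.t e = w (i + 1)

variable {Y}

theorem HasPath.cons {S : Set E} {n : ℕ} {b : V} {e : E} (he : e ∈ S)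
    (h : Y.HasPath S n (Y.t e) b) : Y.HasPath S (n + 1) (Y.o e) b := by
  obtain ⟨w, h0, hn, hw⟩ := h
  refine ⟨fun i => Nat.casesOn i (Y.o e) w, rfl, hn, ?_⟩
  rintro (_ | i) hi
  · exact ⟨e, he, rfl, h0.symm⟩
  · exact hw i (by omega)

theorem HasPath.exists_step {S : Set E} {n : ℕ} {a b : V} (h : Y.HasPath S (n + 1) a b) :
    ∃ e ∈ S, Y.o e = a ∧ Y.HasPath S n (Y.t e) b := by
  obtain ⟨w, h0, hn, hw⟩ := h
  obtain ⟨e, he, ho, ht⟩ := hw 0 (by omega)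
  exact ⟨e, he, ho.trans h0, fun i => w (i + 1), ht.symm, hn, fun i hi => hw (i + 1) (by omega)⟩

theorem Joined.exists_hasPath {S : Set E} {a b : V} (h : Y.Joined S a b) :
    ∃ n, Y.HasPath S n a b := by
  induction h using Relation.ReflTransGen.head_induction_on with
  | refl => exact ⟨0, fun _ => b, rfl, rfl, fun i hi => absurd hi (by omega)⟩
  | head hab _ ih =>
    obtain ⟨e, he, rfl, rfl⟩ := hab
    obtain ⟨n, hn⟩ := ih
    exact ⟨n + 1, hn.cons he⟩

theorem Joined.symm {S : Set E} (hS : ∀ e ∈ S, Y.inv e ∈ S) {a b : V} (h : Y.Joined S a b) :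
    Y.Joined S b a := by
  induction h with
  | refl => exact Relation.ReflTransGen.refl
  | tail _ h ih =>
    obtain ⟨e, he, rfl, rfl⟩ := h
    exact Relation.ReflTransGen.head ⟨Y.inv e, hS e he, Y.o_inv e, Y.t_inv e⟩ ih

/-- A path of minimal length passes through no vertex twice. -/
theorem HasPath.exists_injOn {S : Set E} {a b : V} (h : ∃ n, Y.HasPath S n a b) :
    ∃ (n : ℕ) (w : ℕ → V), w 0 = a ∧ w n = b ∧
      (∀ i < n, ∃ e ∈ S, Y.o e = w i ∧ Y.t e = w (i + 1)) ∧
      ∀ i j, i < j → j ≤ n → w i ≠ w j := by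
  classical
  obtain ⟨w, h0, hn, hw⟩ := Nat.find_spec h
  refine ⟨Nat.find h, w, h0, hn, hw, fun i j hij hj hwij => ?_⟩
  -- If the path visits one vertex at times `i < j`, cutting out the closed part between them gives
  -- a shorter path.
  refine Nat.find_min h (m := Nat.find h - (j - i)) (by omega)
    ⟨fun k => if k ≤ i then w k else w (k + (j - i)), by simp [h0], ?_, fun k hk => ?_⟩
  · by_cases hc : Nat.find h - (j - i) ≤ i
    · have h1 : Nat.find h = j := by omega
      have h2 : Nat.find h - (j - i) = i := by omega
      simp only [h2, le_refl, if_true]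
      rw [hwij, ← h1, hn]
    · simp only [hc, if_false]
      rw [Nat.sub_add_cancel (by omega), hn]
  · rcases lt_trichotomy k i with hki | rfl | hki
    · simpa [hki.le, Nat.succ_le_of_lt hki] using hw k (by omega)
    · have := hw j (by omega)
      simpa [hwij, show k + 1 + (j - k) = j + 1 by omega] using this
    · have := hw (k + (j - i)) (by omega)
      simpa [show ¬ k ≤ i by omega, show ¬ k + 1 ≤ i by omega,
        show k + 1 + (j - i) = k + (j - i) + 1 by omega] using this

/-- Adding a geometric edge to a connected subgraph creates a circuit. -/
theorem exists_isCircuit {S : Set E} (hS : ∀ e ∈ S, Y.inv e ∈ S) {e : E} (he : e ∉ S)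
    (h : Y.Joined S (Y.t e) (Y.o e)) :
    ∃ (n : ℕ) (c : Fin (n + 1) → E), (∀ i, c i = e ∨ c i ∈ S) ∧ Y.IsCircuit c := by
  obtain ⟨n, w, h0, hn, hw, hinj⟩ := HasPath.exists_injOn h.exists_hasPath
  have : Nonempty E := ⟨e⟩
  choose! q hqS hqo hqt using hw
  have hie : Y.inv e ∉ S := fun hc => he (by simpa [Y.inv_inv] using hS _ hc)
  have hoc : ∀ i : Fin (n + 1), Y.o (if (i : ℕ) < n then q i else e) = w i := by
    intro i
    split_ifs with hi
    · exact hqo i hi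
    · rw [← hn, show (i : ℕ) = n by omega]
  -- The circuit follows a simple path in `S` from `t e` to `o e` and closes it with `e` at index
  -- `n`. For `n = 0` it is the loop `e`, which does not backtrack because `inv e ≠ e`.
  refine ⟨n, fun i => if (i : ℕ) < n then q i else e, fun i => ?_, ⟨fun i => ?_, fun i => ?_, ?_⟩⟩
  · by_cases hi : (i : ℕ) < n
    · simp [hi, hqS]
    · simp [hi]
  · rw [hoc]
    by_cases hi : (i : ℕ) < n
    · rw [if_pos hi, hqt i hi, Fin.val_add_one_of_lt (Fin.lt_def.2 (by simpa using hi))]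
    · have hl : i = Fin.last n := Fin.ext (by simp; omega)
      subst hl
      simp [h0]
  · by_cases hi : (i : ℕ) < n
    · have hv : ((i + 1 : Fin (n + 1)) : ℕ) = i + 1 :=
        Fin.val_add_one_of_lt (Fin.lt_def.2 (by simpa using hi))
      simp only [hv, if_pos hi]
      split_ifs with hi1
      · intro hc
        have := hqt (i + 1) hi1
        rw [hc, Y.t_inv, hqo i hi] at this
        exact hinj i (i + 1 + 1) (by omega) (by omega) this
      · intro hc
        exact he (hc ▸ hS _ (hqS i hi))
    · have hl : i = Fin.last n := Fin.ext (by simp; omega)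
      subst hl
      simp only [Fin.last_add_one, Fin.val_zero, Fin.val_last, lt_self_iff_false, if_false]
      split_ifs with h1
      · intro hc
        exact hie (hc ▸ hqS 0 h1)
      · exact (Y.inv_ne e).symm
  · intro i j hij
    simp only [hoc] at hij
    rcases lt_trichotomy i j with hlt | heq | hlt
    · exact absurd hij (hinj i j hlt (by omega))
    · exact heq
    · exact absurd hij.symm (hinj j i hlt (by omega))

/-- A spanning tree is minimal among connected spanning subgraphs. -/
theorem IsSpanningTree.eq_of_subset {S T : Set E} (hT : Y.IsSpanningTree T)
    (hS : ∀ e ∈ S, Y.inv e ∈ S) (hconn : ∀ v w, Y.Joined S v w) (hST : S ⊆ T) : S = T := by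
  refine hST.antisymm fun e he => ?_
  by_contra hc
  obtain ⟨n, c, hcS, hcc⟩ := exists_isCircuit hS hc (hconn _ _)
  exact hT.acyclic n c (fun i => (hcS i).elim (fun h => h ▸ he) fun h => hST h) hcc

/-! ### Spanning trees as arborescences -/

variable (Y) in
/-- A choice, for every vertex except `r`, of a directed edge with this vertex as origin, such that
following these edges always leads to `r`. -/
structure IsArborescence (r : V) (s : V → Option E) : Prop where
  root : s r = none
  parent : ∀ v, v ≠ r → ∃ e, Y.o e = v ∧ s v = some e
  wf : ∃ d : V → ℕ, ∀ v e, s v = some e → d (Y.t e) < d v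

variable (Y) in
/-- The set of directed edges of the subgraph given by a choice of edges `s`. -/
def supportEdges (s : V → Option E) : Set E :=
  {e | s (Y.o e) = some e ∨ s (Y.t e) = some (Y.inv e)}

theorem inv_mem_supportEdges {s : V → Option E} {e : E} (he : e ∈ Y.supportEdges s) :
    Y.inv e ∈ Y.supportEdges s := by
  simpa [supportEdges, Y.o_inv, Y.t_inv, Y.inv_inv, or_comm] using he

namespace IsArborescence

variable {r : V} {s s' : V → Option E}

theorem o_eq (hs : Y.IsArborescence r s) {v : V} {e : E} (h : s v = some e) : Y.o e = v := by
  by_cases hv : v = r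
  · subst hv
    simp [hs.root] at h
  · obtain ⟨e', he', h'⟩ := hs.parent v hv
    rw [h, Option.some.injEq] at h'
    rwa [h']

/-- Each chosen edge lowers the depth `d`, so every vertex descends to `r`. At a vertex of maximal
depth on a circuit, the outgoing edge and the inverse of the incoming edge must both be the edge
chosen there, which is a backtracking. -/
theorem isSpanningTree (hs : Y.IsArborescence r s) : Y.IsSpanningTree (Y.supportEdges s) where
  inv_mem _ := inv_mem_supportEdges
  connected := by
    obtain ⟨d, hd⟩ := hs.wf
    have key : ∀ n v, d v = n → Y.Joined (Y.supportEdges s) v r := by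
      intro n
      induction n using Nat.strong_induction_on with
      | _ n ih =>
        rintro v rfl
        by_cases hv : v = r
        · subst hv
          exact Relation.ReflTransGen.refl
        · obtain ⟨e, rfl, he⟩ := hs.parent v hv
          exact Relation.ReflTransGen.head ⟨e, Or.inl he, rfl, rfl⟩ (ih _ (hd _ _ he) _ rfl)
    exact fun v w => (key _ v rfl).trans ((key _ w rfl).symm fun _ => inv_mem_supportEdges)
  acyclic n c hcS hc := by
    obtain ⟨d, hd⟩ := hs.wf
    obtain ⟨i, hi⟩ := Finite.exists_max fun i => d (Y.o (c i))
    have h1 : s (Y.o (c i)) = some (c i) := by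
      refine (hcS i).resolve_right fun h => ?_
      have h2 := hd _ _ h
      rw [Y.t_inv, hc.closed] at h2
      exact absurd (hi (i + 1)) (by omega)
    have hcl := hc.closed (i - 1)
    rw [sub_add_cancel] at hcl
    have h3 : s (Y.t (c (i - 1))) = some (Y.inv (c (i - 1))) := by
      refine (hcS (i - 1)).resolve_left fun h => ?_
      have h2 := hd _ _ h
      rw [hcl] at h2
      exact absurd (hi (i - 1)) (by omega)
    rw [hcl, h1, Option.some.injEq] at h3
    exact hc.no_backtrack (i - 1) (by rwa [sub_add_cancel])

/-- Induction on the depth for `s`. If `s` chooses `e` at `v` and `s'` does not, then `s'` chooses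
`inv e` at `t e`. By induction so does `s`, and the depth would decrease along `e` in both
directions. -/
theorem eq_of_supportEdges_eq (hs : Y.IsArborescence r s) (hs' : Y.IsArborescence r s')
    (h : Y.supportEdges s = Y.supportEdges s') : s = s' := by
  obtain ⟨d, hd⟩ := hs.wf
  have key : ∀ n v, d v = n → s v = s' v := by
    intro n
    induction n using Nat.strong_induction_on with
    | _ n ih =>
      rintro v rfl
      by_cases hv : v = r
      · subst hv
        rw [hs.root, hs'.root]
      · obtain ⟨e, rfl, he⟩ := hs.parent v hv
        have hmem : e ∈ Y.supportEdges s' := h ▸ Or.inl he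
        rcases hmem with h1 | h1
        · rw [he, h1]
        · have h2 := ih _ (hd _ _ he) _ rfl
          rw [h1] at h2
          have h3 := hd _ _ h2
          have h4 := hd _ _ he
          rw [Y.t_inv] at h3
          omega
  exact funext fun v => key _ v rfl

end IsArborescence

/-- A connected subgraph contains an arborescence with a given root. -/
theorem exists_isArborescence {S : Set E} (hS : ∀ e ∈ S, Y.inv e ∈ S) (r : V)
    (hconn : ∀ v, Y.Joined S v r) :
    ∃ s, Y.IsArborescence r s ∧ Y.supportEdges s ⊆ S := by
  classical
  have hp := fun v => (hconn v).exists_hasPath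
  -- The edge chosen at `v` is the first edge of a shortest path in `S` to `r`; the depth is the
  -- distance to `r`.
  have hstep : ∀ v, v ≠ r → ∃ e ∈ S, Y.o e = v ∧ Nat.find (hp (Y.t e)) < Nat.find (hp v) := by
    intro v hv
    obtain ⟨n, hn⟩ : ∃ n, Nat.find (hp v) = n + 1 := by
      refine Nat.exists_eq_succ_of_ne_zero fun h0 => hv ?_
      obtain ⟨w, hw0, hw1, -⟩ := Nat.find_spec (hp v)
      rw [← hw0, ← hw1, h0]
    have h1 := Nat.find_spec (hp v)
    rw [hn] at h1
    obtain ⟨e, he, ho, h2⟩ := h1.exists_step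
    exact ⟨e, he, ho, by rw [hn]; exact Nat.lt_succ_of_le (Nat.find_min' _ h2)⟩
  choose q hqS hqo hqd using hstep
  have hs : ∀ v e, (if hv : v = r then none else some (q v hv)) = some e →
      ∃ hv : v ≠ r, q v hv = e := by
    intro v e h
    split_ifs at h with hv
    exact ⟨hv, Option.some.inj h⟩
  refine ⟨fun v => if hv : v = r then none else some (q v hv), ⟨by simp, fun v hv => ?_, ?_⟩, ?_⟩
  · exact ⟨q v hv, hqo v hv, by simp [hv]⟩
  · refine ⟨fun v => Nat.find (hp v), fun v e h => ?_⟩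
    obtain ⟨hv, rfl⟩ := hs v e h
    exact hqd v hv
  · rintro e (h | h)
    · obtain ⟨hv, h⟩ := hs _ _ h
      exact h ▸ hqS _ hv
    · obtain ⟨hv, h⟩ := hs _ _ h
      rw [← Y.inv_inv e]
      exact hS _ (h ▸ hqS _ hv)

/-- The spanning trees correspond to the arborescences with a given root. -/
theorem ncard_isArborescence (r : V) :
    {s | Y.IsArborescence r s}.ncard = Y.numSpanningTrees := by
  have hinj : Set.InjOn Y.supportEdges {s | Y.IsArborescence r s} :=
    fun s hs s' hs' h => IsArborescence.eq_of_supportEdges_eq hs hs' h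
  rw [numSpanningTrees, ← hinj.ncard_image]
  congr 1
  ext S
  constructor
  · rintro ⟨s, hs, rfl⟩
    exact hs.isSpanningTree
  · intro hS
    obtain ⟨s, hs, hsS⟩ := exists_isArborescence hS.inv_mem r fun v => hS.connected v r
    exact ⟨s, hs, hS.eq_of_subset (fun _ => inv_mem_supportEdges) hs.isSpanningTree.connected hsS⟩

theorem Connected.numSpanningTrees_ne_zero [Finite E] (hY : Y.Connected) (r : V) :
    Y.numSpanningTrees ≠ 0 := by
  obtain ⟨s, hs, -⟩ := exists_isArborescence (S := Set.univ) (fun _ _ => trivial) r fun v => hY v r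
  exact Set.ncard_ne_zero_of_mem (s := {S | Y.IsSpanningTree S}) hs.isSpanningTree

end SerreGraph

/-! ### The matrix tree theorem -/

/-- The derivative of a determinant, row by row. -/
theorem Polynomial.derivative_det {n R : Type*} [Fintype n] [DecidableEq n] [CommRing R]
    (M : Matrix n n R[X]) :
    Polynomial.derivative M.det =
      ∑ v, (M.updateRow v fun w => Polynomial.derivative (M v w)).det := by
  -- After transposition the Leibniz product is indexed by the rows of `M`, so differentiating one
  -- factor alters one row.
  simp_rw [← Matrix.det_transpose M, ← Matrix.det_transpose (Matrix.updateRow _ _ _),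
    Matrix.det_apply, Matrix.transpose_apply]
  rw [Polynomial.derivative_sum, Finset.sum_comm]
  refine Finset.sum_congr rfl fun σ _ => ?_
  rw [← Finset.smul_sum, Units.smul_def, Units.smul_def, map_zsmul,
    Polynomial.derivative_prod_finset]
  congr 1
  refine Finset.sum_congr rfl fun v _ => ?_
  rw [← Finset.prod_erase_mul _ _ (Finset.mem_univ v), Matrix.updateRow_self]
  congr 1
  refine Finset.prod_congr rfl fun j hj => ?_
  rw [Matrix.updateRow_ne (Finset.ne_of_mem_erase hj)]

namespace SerreGraph

variable {V E : Type*} [Fintype V] [DecidableEq V] [Fintype E] (Y : SerreGraph V E)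

/-- The Laplace matrix, whose row at `v` is the sum of `v - t(e)` over the directed edges `e` with
origin `v`. -/
noncomputable def laplaceMatrix : Matrix V V ℂ :=
  Matrix.of fun v => ∑ e ∈ Y.edgesFrom v, (Pi.single v 1 - Pi.single (Y.t e) 1)

/-- The row which belongs to the vertex `v` and to a choice of an edge with origin `v`, or of no
edge. -/
noncomputable def choiceRow (v : V) : Option E → V → ℂ
  | none => Pi.single v 1
  | some e => Pi.single v 1 - Pi.single (Y.t e) 1

/-- The possible values at `v` of an arborescence with root `r`. -/
noncomputable def choices (r v : V) : Finset (Option E) :=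
  if v = r then {none} else (Y.edgesFrom v).map Function.Embedding.some

variable {Y}

omit [Fintype V] [DecidableEq V] in
theorem mem_edgesFrom {v : V} {e : E} : e ∈ Y.edgesFrom v ↔ Y.o e = v := by
  simp [edgesFrom]

omit [Fintype V] in
theorem mem_choices {r v : V} {x : Option E} :
    x ∈ Y.choices r v ↔ (v = r ∧ x = none) ∨ (v ≠ r ∧ ∃ e, Y.o e = v ∧ x = some e) := by
  by_cases h : v = r
  · simp [choices, h]
  · simp [choices, h, mem_edgesFrom, eq_comm]

omit [Fintype V] in
theorem isArborescence_iff {r : V} {s : V → Option E} (hs : ∀ v, s v ∈ Y.choices r v) :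
    Y.IsArborescence r s ↔ ∃ d : V → ℕ, ∀ v e, s v = some e → d (Y.t e) < d v := by
  refine ⟨fun h => h.wf, fun h => ⟨?_, fun v hv => ?_, h⟩⟩
  · simpa [mem_choices] using hs r
  · simpa [mem_choices, hv] using hs v

-- Off the diagonal, row `v` is nonzero only at the end of the chosen edge, which has smaller depth.
-- The matrix is thus block triangular for the depth, with identity diagonal blocks.
omit [Fintype E] in
theorem det_choiceRow_of_isArborescence {r : V} {s : V → Option E} (hs : Y.IsArborescence r s) :
    (Matrix.of fun v => Y.choiceRow v (s v)).det = 1 := by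
  obtain ⟨d, hd⟩ := hs.wf
  have hM : ∀ v w, d v ≤ d w →
      Y.choiceRow v (s v) w = (1 : Matrix V V ℂ) v w := by
    intro v w hvw
    cases h : s v with
    | none => simp [choiceRow, Pi.single_apply, Matrix.one_apply, eq_comm]
    | some e =>
      have h1 : w ≠ Y.t e := by
        rintro rfl
        exact absurd (hd _ _ h) (by omega)
      simp [choiceRow, Pi.single_apply, Matrix.one_apply, h1, eq_comm (a := w) (b := v)]
  have hb : (Matrix.of fun v => Y.choiceRow v (s v)).BlockTriangular
      (fun v => OrderDual.toDual (d v)) := by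
    intro v w hvw
    have hvw : d v < d w := hvw
    rw [Matrix.of_apply, hM v w hvw.le, Matrix.one_apply_ne]
    rintro rfl
    exact lt_irrefl _ hvw
  rw [hb.det]
  refine Finset.prod_eq_one fun a _ => ?_
  rw [show Matrix.toSquareBlock _ _ a = 1 from ?_, Matrix.det_one]
  ext ⟨v, hv⟩ ⟨w, hw⟩
  have hvw : d v = d w := OrderDual.toDual.injective (hv.trans hw.symm)
  simp [Matrix.toSquareBlock_def, hM v w hvw.le, Matrix.one_apply]

/-- The indicator of the vertices from which the chosen edges never lead to `r` is a kernel vector,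
since `v` and its successor behave alike. It is nonzero: otherwise the number of steps to `r` would
be a depth. -/
theorem det_choiceRow_of_not_isArborescence {r : V} {s : V → Option E}
    (hs : ∀ v, s v ∈ Y.choices r v) (h : ¬ Y.IsArborescence r s) :
    (Matrix.of fun v => Y.choiceRow v (s v)).det = 0 := by
  classical
  let step : V → V := fun v => (s v).elim v Y.t
  have hsr : s r = none := by simpa [mem_choices] using hs r
  have hstep_r : step r = r := by simp [step, hsr]
  have hit : ∀ v, (∃ n, step^[n] (step v) = r) ↔ ∃ n, step^[n] v = r := by
    refine fun v => ⟨fun ⟨n, hn⟩ => ⟨n + 1, hn⟩, fun ⟨n, hn⟩ => ⟨n, ?_⟩⟩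
    rw [← Function.iterate_succ_apply, Function.iterate_succ_apply', hn, hstep_r]
  have hex : ∃ v, ¬ ∃ n, step^[n] v = r := by
    by_contra! hc
    refine h ((isArborescence_iff hs).2 ⟨fun v => Nat.find (hc v), fun v e hv => ?_⟩)
    have hsv : step v = Y.t e := by simp [step, hv]
    have h0 : Nat.find (hc v) ≠ 0 := by
      intro h0
      have := Nat.find_spec (hc v)
      rw [h0, Function.iterate_zero_apply] at this
      simp [this, hsr] at hv
    obtain ⟨n, hn⟩ := Nat.exists_eq_succ_of_ne_zero h0
    have h1 := Nat.find_spec (hc v)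
    rw [hn, Function.iterate_succ_apply, hsv] at h1
    change Nat.find _ < Nat.find (hc v)
    rw [hn]
    exact Nat.lt_succ_of_le (Nat.find_min' _ h1)
  obtain ⟨v₀, hv₀⟩ := hex
  refine Matrix.exists_mulVec_eq_zero_iff.1
    ⟨fun v => if ∃ n, step^[n] v = r then 0 else 1, fun hc => ?_, funext fun v => ?_⟩
  · simpa [hv₀] using congrFun hc v₀
  · change Y.choiceRow v (s v) ⬝ᵥ _ = 0
    have hv := hs v
    rw [mem_choices] at hv
    rcases hv with ⟨rfl, hv⟩ | ⟨-, e, -, hv⟩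
    · rw [hv, choiceRow, single_one_dotProduct, if_pos ⟨0, rfl⟩]
    · have hsv : step v = Y.t e := by simp [step, hv]
      rw [hv, choiceRow, sub_dotProduct, single_one_dotProduct, single_one_dotProduct, ← hsv]
      simp only [hit, sub_self]

/-- The matrix tree theorem: the determinant of the Laplace matrix, with the row of the vertex `r`
replaced by a unit vector, is the number of spanning trees. -/
theorem det_laplaceMatrix_updateRow (r : V) :
    (Y.laplaceMatrix.updateRow r (Pi.single r 1)).det = Y.numSpanningTrees := by
  classical
  have hrow : Y.laplaceMatrix.updateRow r (Pi.single r 1) =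
      Matrix.of fun v => ∑ x ∈ Y.choices r v, Y.choiceRow v x := by
    ext1 v
    by_cases hv : v = r
    · subst hv
      simp [choices, choiceRow]
    · simp [choices, hv, choiceRow, laplaceMatrix]
  rw [hrow]
  -- Multilinearity in the rows turns the determinant into a sum over all choices of one edge at
  -- each vertex other than `r`.
  have := (Matrix.detRowAlternating (R := ℂ) (n := V)).toMultilinearMap.map_sum_finset
    (fun v x => Y.choiceRow v x) (Y.choices r)
  refine this.trans ?_
  rw [← ncard_isArborescence r, Set.ncard_eq_toFinset_card', Finset.card_eq_sum_ones, Nat.cast_sum]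
  symm
  refine Finset.sum_subset_zero_on_sdiff (fun s hs => ?_) (fun s hs => ?_) (fun s hs => ?_)
  · have hs : Y.IsArborescence r s := by simpa using hs
    rw [Fintype.mem_piFinset]
    intro v
    rw [mem_choices]
    by_cases hv : v = r
    · subst hv
      exact Or.inl ⟨rfl, hs.root⟩
    · exact Or.inr ⟨hv, hs.parent v hv⟩
  · simp only [Finset.mem_sdiff, Fintype.mem_piFinset, Set.mem_toFinset, Set.mem_ofPred_eq] at hs
    exact det_choiceRow_of_not_isArborescence hs.1 hs.2
  · have hs : Y.IsArborescence r s := by simpa using hs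
    exact Nat.cast_one.trans (det_choiceRow_of_isArborescence hs).symm

theorem laplaceMatrix_mulVec_one : Y.laplaceMatrix.mulVec 1 = 0 := by
  ext v
  change (∑ e ∈ Y.edgesFrom v, (Pi.single v 1 - Pi.single (Y.t e) 1)) ⬝ᵥ (1 : V → ℂ) = 0
  simp_rw [sum_dotProduct, sub_dotProduct, single_one_dotProduct]
  simp

theorem det_laplaceMatrix [Nonempty V] : Y.laplaceMatrix.det = 0 :=
  Matrix.exists_mulVec_eq_zero_iff.1 ⟨1, one_ne_zero, laplaceMatrix_mulVec_one⟩

/-! ### The Ihara polynomial at `u = 1` -/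

variable (Y) in
/-- The diagonal matrix of the numbers of directed edges with given origin. -/
noncomputable def degreeMatrix : Matrix V V ℂ :=
  Matrix.diagonal fun v => ((Y.edgesFrom v).card : ℂ)

variable (Y) in
/-- The polynomial `det (I - A u + (D - I) u²)`. -/
noncomputable def iharaPolynomial : ℂ[X] :=
  (1 - (Polynomial.X : ℂ[X]) • (Y.degreeMatrix - Y.laplaceMatrix).map Polynomial.C
    + (Polynomial.X ^ 2 : ℂ[X]) • (Y.degreeMatrix - 1).map Polynomial.C).det

theorem eval_iharaPolynomial (z : ℂ) : Y.iharaPolynomial.eval z =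
    (1 - z • (Y.degreeMatrix - Y.laplaceMatrix) + z ^ 2 • (Y.degreeMatrix - 1)).det := by
  rw [iharaPolynomial, ← Polynomial.coe_evalRingHom, RingHom.map_det]
  congr 1
  ext v w
  by_cases h : v = w <;> (simp [h]; try ring)

theorem sum_card_edgesFrom : ∑ v, (Y.edgesFrom v).card = Fintype.card E := by
  classical
  rw [← Finset.card_univ, Finset.card_eq_sum_card_fiberwise (f := Y.o) (t := Finset.univ) (by simp)]
  exact Finset.sum_congr rfl fun v _ => congrArg Finset.card (by ext; simp [mem_edgesFrom])

/-- The derivative at `1` of the Ihara polynomial. -/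
theorem eval_derivative_iharaPolynomial [Nonempty V] :
    (Polynomial.derivative Y.iharaPolynomial).eval 1 =
      ((Fintype.card E : ℂ) - 2 * Fintype.card V) * Y.numSpanningTrees := by
  rw [iharaPolynomial, Polynomial.derivative_det, Polynomial.eval_finsetSum,
    ← sum_card_edgesFrom (Y := Y), Nat.cast_sum, ← Finset.card_univ, mul_comm (2 : ℂ),
    ← nsmul_eq_mul, ← Finset.sum_const, ← Finset.sum_sub_distrib, Finset.sum_mul]
  refine Finset.sum_congr rfl fun v _ => ?_
  rw [← Polynomial.coe_evalRingHom, RingHom.map_det]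
  -- At `u = 1` the matrix is `L`, and the derivative of row `v` is row `v` of `-A + 2(D - I) = L +
  -- (D - 2)`. The first summand contributes `det L = 0`, the second the minor `κ`.
  have h : ∀ N : Matrix V V ℂ, N = Y.laplaceMatrix.updateRow v (Y.laplaceMatrix v +
      (((Y.edgesFrom v).card : ℂ) - 2) • Pi.single v 1) →
      N.det = (((Y.edgesFrom v).card : ℂ) - 2) * Y.numSpanningTrees := by
    rintro N rfl
    rw [Matrix.det_updateRow_add, Matrix.updateRow_eq_self, det_laplaceMatrix, zero_add,
      Matrix.det_updateRow_smul, det_laplaceMatrix_updateRow]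
  refine h _ ?_
  ext a b
  by_cases ha : a = v
  · subst ha
    by_cases hb : a = b
    · subst hb
      simp [degreeMatrix]
      ring
    · simp [hb, Ne.symm hb, degreeMatrix]
  · by_cases hb : a = b
    · subst hb
      simp [ha, degreeMatrix]
    · simp [ha, hb, degreeMatrix]

end SerreGraph

/-! ### Determinants through presentations -/

section LinearAlgebra

theorem LinearMap.det_id_add_comp_comm {K M N : Type*} [CommRing K] [AddCommGroup M] [Module K M]
    [AddCommGroup N] [Module K N] [Module.Free K M] [Module.Finite K M] [Module.Free K N]
    [Module.Finite K N] (f : M →ₗ[K] N) (g : N →ₗ[K] M) :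
    LinearMap.det (LinearMap.id + f ∘ₗ g) = LinearMap.det (LinearMap.id + g ∘ₗ f) := by
  classical
  let b := Module.Free.chooseBasis K M
  let c := Module.Free.chooseBasis K N
  rw [← LinearMap.det_toMatrix b, ← LinearMap.det_toMatrix c, map_add, map_add,
    LinearMap.toMatrix_id, LinearMap.toMatrix_id, LinearMap.toMatrix_comp c b c,
    LinearMap.toMatrix_comp b c b, Matrix.det_one_add_mul_comm]

theorem LinearMap.IsProj.trace_eq_finrank {K M : Type*} [Field K] [AddCommGroup M] [Module K M]
    [Module.Finite K M] {W : Submodule K M} {f : M →ₗ[K] M} (h : LinearMap.IsProj W f) :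
    LinearMap.trace K M f = Module.finrank K W :=
  h.trace

variable {R M : Type*} [CommRing R] [AddCommGroup M] [Module R M]

/-- The determinant of `I - A u + (D - I) u²` in terms of a presentation of the projective
module. -/
theorem projDet_threeTermOp [Module.Finite R M] [Module.Projective R M] (A D : M →ₗ[R] M) {n : ℕ}
    (p : (Fin n → R) →ₗ[R] M) (i : M →ₗ[R] (Fin n → R)) (h : p ∘ₗ i = LinearMap.id) :
    projDet (threeTermOp A D) =
      (1 - (Polynomial.X : R[X]) • (LinearMap.toMatrix' (i ∘ₗ A ∘ₗ p)).map Polynomial.C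
        + (Polynomial.X ^ 2 : R[X]) •
          (LinearMap.toMatrix' (i ∘ₗ (D - LinearMap.id) ∘ₗ p)).map Polynomial.C).det := by
  let e : (R[X] ⊗[R] (Fin n → R)) ≃ₗ[R[X]] (Fin n → R[X]) :=
    TensorProduct.piScalarRight R R[X] R[X] (Fin n)
  have hk := Module.Finite.exists_comp_eq_id_of_projective R[X] (R[X] ⊗[R] M)
  unfold projDet
  -- Independence of the presentation allows one extended from `R` to `R[X]`, whose matrices have
  -- constant entries.
  rw [det_split_eq _ _ _ hk.choose_spec.choose_spec.choose_spec.2.2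
    (p.baseChange R[X] ∘ₗ e.symm.toLinearMap) (e.toLinearMap ∘ₗ i.baseChange R[X])
    (by
      ext x
      have := LinearMap.congr_fun h x
      simp only [LinearMap.comp_apply, LinearMap.id_apply] at this
      simp [this]), ← LinearMap.det_toMatrix']
  congr 1
  ext1 j k
  have he : e.symm (Pi.single k 1) = 1 ⊗ₜ Pi.single k 1 := by
    rw [LinearEquiv.symm_apply_eq]
    ext l
    by_cases hl : l = k
    · subst hl; simp [e]
    · simp [e, hl]
  simp only [LinearMap.toMatrix'_apply, LinearMap.add_apply, LinearMap.sub_apply,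
    LinearMap.comp_apply, LinearEquiv.coe_coe, LinearMap.id_apply, he, threeTermOp,
    LinearMap.baseChange_tmul, LinearMap.smul_apply, map_add, map_sub, map_smul, Pi.add_apply,
    Pi.sub_apply, Pi.smul_apply, Matrix.add_apply, Matrix.sub_apply, Matrix.smul_apply,
    Matrix.map_apply, e, TensorProduct.piScalarRight_apply, TensorProduct.piScalarRightHom_tmul]
  have h1 : ∀ x : R, x • (1 : R[X]) = Polynomial.C x := fun x => by
    rw [← Polynomial.C_1, Polynomial.smul_C, smul_eq_mul, mul_one]
  simp only [h1, Matrix.one_apply, Pi.single_apply]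
  simp only [smul_eq_mul, map_sub]
  ring

end LinearAlgebra

/-! ### The norm of the group algebra -/

section GroupAlgebra

variable {G : Type*} [CommGroup G]

/-- The `ℂ`-algebra morphism `ℂ[G] → ℂ` which extends a character. -/
noncomputable def characterEval (ψ : G →* ℂˣ) : MonoidAlgebra ℂ G →ₐ[ℂ] ℂ :=
  MonoidAlgebra.lift ℂ ℂ G ((Units.coeHom ℂ).comp ψ)

theorem characterEval_single (ψ : G →* ℂˣ) (g : G) (c : ℂ) :
    characterEval ψ (MonoidAlgebra.single g c) = c * ψ g := by
  simp [characterEval]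

/-- Dedekind's linear independence of characters. -/
theorem isUnit_characterTable [Fintype G] [DecidableEq G] (e : G ≃ (G →* ℂˣ)) :
    IsUnit (Matrix.of fun a g : G => ((e a g : ℂˣ) : ℂ)) := by
  rw [← Matrix.linearIndependent_rows_iff_isUnit]
  have h := linearIndependent_monoidHom G ℂ
  exact h.comp (fun a => (Units.coeHom ℂ).comp (e a)) fun a b hab => e.injective
    (MonoidHom.ext fun g => Units.ext (DFunLike.congr_fun hab g))

/-- The norm of an element of the group algebra is the product of its values at the characters. -/
theorem norm_eq_prod_characterEval [Finite G] [Fintype (G →* ℂˣ)] (x : MonoidAlgebra ℂ G) :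
    Algebra.norm ℂ x = ∏ ψ : G →* ℂˣ, characterEval ψ x := by
  classical
  have := Fintype.ofFinite G
  have e : G ≃ (G →* ℂˣ) := by
    have h := CommGroup.card_monoidHom_of_hasEnoughRootsOfUnity G ℂ
    rw [Nat.card_eq_fintype_card, Nat.card_eq_fintype_card] at h
    exact Fintype.equivOfCardEq h.symm
  set T : Matrix G G ℂ := Matrix.of fun a g : G => ((e a g : ℂˣ) : ℂ) with hT
  let b : Module.Basis G ℂ (MonoidAlgebra ℂ G) := MonoidAlgebra.basis G ℂ
  rw [← Equiv.prod_comp e, Algebra.norm_apply, ← LinearMap.det_toMatrix b, ← Matrix.det_diagonal]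
  -- The character table diagonalises multiplication by `x`, because characters are multiplicative;
  -- its determinant cancels below.
  have hcomm : T * LinearMap.toMatrix b b (Algebra.lmul ℂ _ x) =
      Matrix.diagonal (fun a => characterEval (e a) x) * T := by
    ext a g
    rw [Matrix.diagonal_mul, Matrix.mul_apply]
    have h1 : characterEval (e a) (x * MonoidAlgebra.single g 1) =
        characterEval (e a) x * T a g := by
      rw [map_mul, characterEval_single, one_mul]; rfl
    have h2 : b g = MonoidAlgebra.single g 1 := by simp [b]
    conv_rhs => rw [← h1, ← h2, ← b.sum_repr (x * b g), map_sum]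
    refine Finset.sum_congr rfl fun c _ => ?_
    rw [map_smul, LinearMap.toMatrix_apply, smul_eq_mul, mul_comm]
    congr 1
    simp [b, characterEval, T]
  have hdet := congrArg Matrix.det hcomm
  rw [Matrix.det_mul, Matrix.det_mul, mul_comm] at hdet
  have hu := (Matrix.isUnit_iff_isUnit_det T).1 (isUnit_characterTable e)
  exact hu.mul_right_cancel hdet

end GroupAlgebra

namespace SerreGraph

/-! ### The Euler characteristic by counting -/

section EulerCharacteristic

variable {V E : Type*} [Fintype V] [Fintype E] (Y : SerreGraph V E)

omit [Fintype V] in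
/-- Half the number of directed edges is the dimension of `C₁(Y)`. -/
theorem two_mul_finrank_quotient_invSubspace :
    2 * Module.finrank ℂ ((E →₀ ℂ) ⧸ Y.invSubspace) = Fintype.card E := by
  classical
  let T : (E →₀ ℂ) →ₗ[ℂ] (E →₀ ℂ) := Finsupp.lmapDomain ℂ ℂ Y.inv
  have hT : ∀ x, T (T x) = x := by
    intro x
    simp only [T, Finsupp.lmapDomain_apply, ← Finsupp.mapDomain_comp]
    rw [show Y.inv ∘ Y.inv = id from funext Y.inv_inv, Finsupp.mapDomain_id]
  -- `P` projects onto the span of the `e + inv e`. Its rank is its trace `|E| / 2`, as the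
  -- fixed-point-free `inv` has trace `0`.
  let P : (E →₀ ℂ) →ₗ[ℂ] (E →₀ ℂ) := (2⁻¹ : ℂ) • (LinearMap.id + T)
  have hP : P ∘ₗ P = P := by
    refine LinearMap.ext fun x => ?_
    simp only [P, LinearMap.comp_apply, LinearMap.smul_apply, LinearMap.add_apply,
      LinearMap.id_apply, map_smul, map_add, hT]
    module
  have hrange : LinearMap.range P = Y.invSubspace := by
    apply le_antisymm
    · rintro _ ⟨x, rfl⟩
      induction x using Finsupp.induction_linear with
      | zero => simp
      | add x y hx hy => rw [map_add]; exact add_mem hx hy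
      | single e a =>
        have : P (Finsupp.single e a) = (2⁻¹ * a) •
            (Finsupp.single e (1 : ℂ) + Finsupp.single (Y.inv e) (1 : ℂ)) := by
          simp [P, T, Finsupp.mapDomain_single]
        rw [this]
        exact Submodule.smul_mem _ _ (Submodule.subset_span ⟨e, rfl⟩)
    · rw [invSubspace, Submodule.span_le]
      rintro _ ⟨e, rfl⟩
      refine ⟨Finsupp.single e 1 + Finsupp.single (Y.inv e) 1, ?_⟩
      simp only [P, T, LinearMap.smul_apply, LinearMap.add_apply, LinearMap.id_apply, map_add,
        Finsupp.lmapDomain_apply, Finsupp.mapDomain_single, Y.inv_inv]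
      module
  have htrace : LinearMap.trace ℂ _ P = (Fintype.card E : ℂ) / 2 := by
    have h0 : LinearMap.trace ℂ _ T = 0 := by
      rw [LinearMap.trace_eq_matrix_trace ℂ Finsupp.basisSingleOne, Matrix.trace]
      refine Finset.sum_eq_zero fun e _ => ?_
      simp [LinearMap.toMatrix_apply, T, Finsupp.mapDomain_single, Y.inv_ne e]
    rw [map_smul, map_add, h0, add_zero, LinearMap.trace_id, Module.finrank_finsupp_self,
      smul_eq_mul, div_eq_inv_mul]
  have hproj : IsIdempotentElem P := hP
  have h0 : LinearMap.IsProj Y.invSubspace P :=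
    hrange ▸ LinearMap.IsIdempotentElem.isProj_range P hproj
  have h1 : LinearMap.trace ℂ _ P = Module.finrank ℂ Y.invSubspace := h0.trace_eq_finrank
  rw [htrace] at h1
  have h2 := Submodule.finrank_quotient_add_finrank Y.invSubspace
  rw [Module.finrank_finsupp_self] at h2
  have h3 : Fintype.card E = 2 * Module.finrank ℂ Y.invSubspace := by
    have : (Fintype.card E : ℂ) = 2 * Module.finrank ℂ Y.invSubspace := by
      rw [← h1]; ring
    exact_mod_cast this
  omega

theorem two_mul_eulerChar :
    2 * Y.eulerChar = 2 * (Fintype.card V : ℤ) - (Fintype.card E : ℤ) := by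
  rw [← two_mul_finrank_quotient_invSubspace Y, eulerChar, Module.finrank_finsupp_self]
  push_cast
  ring

end EulerCharacteristic

/-! ### Factorisation over the characters -/

section Characters

variable {V E G : Type*} [Fintype V] [Fintype E] [CommGroup G] [Finite G]
  [MulAction G V] [MulAction G E] (Y : SerreGraph V E) [Y.IsAction G]

/-- The value of `h(u, ψ)` in terms of a presentation of `C₀(Y)`. -/
theorem eval_h {n : ℕ} (p : (Fin n → MonoidAlgebra ℂ G) →ₗ[MonoidAlgebra ℂ G] C0 G V)
    (i : C0 G V →ₗ[MonoidAlgebra ℂ G] (Fin n → MonoidAlgebra ℂ G)) (hpi : p ∘ₗ i = LinearMap.id)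
    (ψ : G →* ℂˣ) (z : ℂ) :
    (Y.h ψ).eval z = characterEval ψ (LinearMap.det (LinearMap.id + i ∘ₗ
      (-(algebraMap ℂ (MonoidAlgebra ℂ G) z) • Y.adjacencyHom G +
        (algebraMap ℂ (MonoidAlgebra ℂ G) z) ^ 2 • (Y.degreeHom G - LinearMap.id)) ∘ₗ p)) := by
  -- As `ψ` fixes scalars, evaluation at `z` may be carried out inside `ℂ[G]` before applying `ψ`.
  have hz : z = (characterEval ψ).toRingHom (algebraMap ℂ (MonoidAlgebra ℂ G) z) := by
    exact ((characterEval ψ).commutes z).symm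
  rw [h, eta, projDet_threeTermOp _ _ p i hpi, Polynomial.eval_map]
  change Polynomial.eval₂ (characterEval ψ).toRingHom z _ = (characterEval ψ).toRingHom _
  conv_lhs => rw [hz]
  rw [Polynomial.eval₂_at_apply, ← Polynomial.coe_evalRingHom, RingHom.map_det,
    ← LinearMap.det_toMatrix']
  congr 2
  ext1 a b
  by_cases hab : a = b
  · subst hab
    simp [LinearMap.toMatrix'_apply]
    ring
  · simp [LinearMap.toMatrix'_apply, hab]
    ring

omit [Finite G] in
/-- The determinant over `ℂ` of the three term operator at a complex number. -/
theorem det_threeTerm_restrictScalars [DecidableEq V] (z : ℂ) :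
    LinearMap.det (LinearMap.id +
      (-(algebraMap ℂ (MonoidAlgebra ℂ G) z) • Y.adjacencyHom G +
        (algebraMap ℂ (MonoidAlgebra ℂ G) z) ^ 2 •
          (Y.degreeHom G - LinearMap.id)).restrictScalars ℂ) = Y.iharaPolynomial.eval z := by
  -- The transpose is needed because `laplaceMatrix` lists the images of the vertices as rows,
  -- `toMatrix` as columns.
  rw [eval_iharaPolynomial, ← LinearMap.det_conj _ (C0.equiv G V),
    ← LinearMap.det_toMatrix Finsupp.basisSingleOne, ← Matrix.det_transpose]
  congr 1
  have key : ∀ x : V →₀ ℂ, ((C0.equiv G V).toLinearMap ∘ₗ (LinearMap.id +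
      (-(algebraMap ℂ (MonoidAlgebra ℂ G) z) • Y.adjacencyHom G +
        (algebraMap ℂ (MonoidAlgebra ℂ G) z) ^ 2 •
          (Y.degreeHom G - LinearMap.id)).restrictScalars ℂ) ∘ₗ
      (C0.equiv G V).symm.toLinearMap) x =
      x - z • Y.adjacencyOp x + z ^ 2 • (Y.degreeOp x - x) := by
    intro x
    have hA : Y.adjacencyHom G ((C0.equiv G V).symm x) =
      (C0.equiv G V).symm (Y.adjacencyOp x) := rfl
    have hD : Y.degreeHom G ((C0.equiv G V).symm x) =
      (C0.equiv G V).symm (Y.degreeOp x) := rfl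
    have hs : ∀ (c : ℂ) (y : C0 G V), algebraMap ℂ (MonoidAlgebra ℂ G) c • y = c • y :=
      fun c y => algebraMap_smul _ c y
    rw [← map_pow, ← map_neg]
    simp only [LinearMap.comp_apply, LinearEquiv.coe_coe, LinearMap.add_apply, LinearMap.id_apply,
      LinearMap.restrictScalars_apply, LinearMap.smul_apply, LinearMap.sub_apply, hA, hD, hs,
      map_add, map_smul, map_sub, LinearEquiv.apply_symm_apply]
    module
  ext a b
  rw [Matrix.transpose_apply, LinearMap.toMatrix_apply, key]
  simp only [Finsupp.coe_basisSingleOne, Finsupp.basisSingleOne_repr, LinearEquiv.refl_apply,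
    degreeOp, adjacencyOp, Finsupp.linearCombination_single, one_smul, Finsupp.add_apply,
    Finsupp.sub_apply, Finsupp.smul_apply, Finsupp.finsetSum_apply, Matrix.add_apply,
    Matrix.sub_apply, Matrix.smul_apply, degreeMatrix, laplaceMatrix, Matrix.of_apply,
    Finset.sum_apply, Pi.sub_apply, Finset.sum_sub_distrib, Finset.sum_const, smul_eq_mul,
    Matrix.diagonal_apply, Matrix.one_apply, Finsupp.single_apply, Pi.single_apply]
  simp only [eq_comm (a := b), nsmul_eq_mul]
  by_cases hab : a = b
  · subst hab
    simp
  · simp [hab]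

/-- The product of the polynomials `h(u, ψ)` over all characters is the Ihara polynomial. -/
theorem prod_h [DecidableEq V] [Fintype (G →* ℂˣ)] :
    ∏ ψ : G →* ℂˣ, Y.h ψ = Y.iharaPolynomial := by
  refine Polynomial.funext fun z => ?_
  obtain ⟨n, p, i, -, -, hpi⟩ :=
    Module.Finite.exists_comp_eq_id_of_projective (MonoidAlgebra ℂ G) (C0 G V)
  have : Module.Finite ℂ (C0 G V) := Module.Finite.equiv (C0.equiv G V).symm
  rw [Polynomial.eval_prod, Finset.prod_congr rfl fun ψ _ => eval_h Y p i hpi ψ z,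
    ← norm_eq_prod_characterEval, ← LinearMap.det_restrictScalars,
    ← det_threeTerm_restrictScalars (G := G)]
  set g : C0 G V →ₗ[MonoidAlgebra ℂ G] C0 G V :=
    -(algebraMap ℂ (MonoidAlgebra ℂ G) z) • Y.adjacencyHom G +
        (algebraMap ℂ (MonoidAlgebra ℂ G) z) ^ 2 • (Y.degreeHom G - LinearMap.id)
  -- Sylvester's identity replaces `id + i g p` on `ℂ[G]ⁿ` by `id + g p i = id + g` on `C₀(Y)`.
  have h1 := LinearMap.det_id_add_comp_comm (i.restrictScalars ℂ)
    ((g ∘ₗ p).restrictScalars ℂ)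
  refine h1.trans ?_
  congr 2
  refine LinearMap.ext fun x => ?_
  have := LinearMap.congr_fun hpi x
  simp only [LinearMap.comp_apply, LinearMap.id_apply] at this
  simp [this]

/-- The augmentation `ℂV → ℂ`. -/
noncomputable def augmentation (G V : Type*) : C0 G V →ₗ[ℂ] ℂ :=
  Finsupp.linearCombination ℂ (fun _ : V => (1 : ℂ)) ∘ₗ (C0.equiv G V).toLinearMap

omit [Fintype V] [Finite G] in
theorem augmentation_smul (a : MonoidAlgebra ℂ G) (x : C0 G V) :
    augmentation G V (a • x) = characterEval 1 a * augmentation G V x := by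
  induction a using MonoidAlgebra.induction_linear with
  | zero => simp
  | add a b ha hb => rw [add_smul, map_add, ha, hb, map_add, add_mul]
  | single g c =>
    rw [characterEval_single, augmentation, LinearMap.comp_apply, LinearMap.comp_apply,
      LinearEquiv.coe_coe, C0.equiv_smul, Representation.asAlgebraHom_single]
    simp [vertexRep, Finsupp.linearCombination_mapDomain, Function.comp_def]

omit [Fintype V] [Finite G] in
theorem augmentation_degreeHom_sub_adjacencyHom (x : C0 G V) :
    augmentation G V ((Y.degreeHom G - Y.adjacencyHom G) x) = 0 := by
  obtain ⟨x, rfl⟩ := (C0.equiv G V).symm.surjective x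
  change Finsupp.linearCombination ℂ (fun _ : V => (1 : ℂ)) (Y.degreeOp x - Y.adjacencyOp x) = 0
  induction x using Finsupp.induction_linear with
  | zero => simp
  | add x y hx hy => rw [map_add, map_add, add_sub_add_comm, map_add, hx, hy, add_zero]
  | single w a =>
    simp only [degreeOp, adjacencyOp, Finsupp.linearCombination_single, map_sub, map_smul, map_sum]
    simp

/-- The augmentation kills the image of `D - A`. Its values on the generators of a presentation form
a left kernel vector of the matrix specialised at the trivial character, nonzero because a vertex
has augmentation `1`. -/
theorem eval_h_one_one [Nonempty V] : (Y.h (1 : G →* ℂˣ)).eval 1 = 0 := by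
  obtain ⟨n, p, i, -, -, hpi⟩ :=
    Module.Finite.exists_comp_eq_id_of_projective (MonoidAlgebra ℂ G) (C0 G V)
  have hpi' : ∀ x, p (i x) = x := fun x => LinearMap.congr_fun hpi x
  rw [eval_h Y p i hpi, ← LinearMap.det_toMatrix', ← AlgHom.coe_toRingHom, RingHom.map_det]
  set N := LinearMap.id + i ∘ₗ
      (-(algebraMap ℂ (MonoidAlgebra ℂ G) 1) • Y.adjacencyHom G +
        (algebraMap ℂ (MonoidAlgebra ℂ G) 1) ^ 2 • (Y.degreeHom G - LinearMap.id)) ∘ₗ p with hN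
  have hpN : ∀ x, augmentation G V (p (N x)) = 0 := by
    intro x
    rw [← augmentation_degreeHom_sub_adjacencyHom Y (p x)]
    congr 1
    simp only [hN, map_one, one_pow, one_smul, neg_smul, LinearMap.add_apply, LinearMap.id_apply,
      LinearMap.comp_apply, map_add, hpi', LinearMap.neg_apply, LinearMap.sub_apply]
    abel
  have hsum : ∀ x : Fin n → MonoidAlgebra ℂ G, augmentation G V (p x) =
      ∑ k, augmentation G V (p (Pi.single k 1)) * characterEval 1 (x k) := by
    intro x
    conv_lhs => rw [pi_eq_sum_univ' x]
    simp only [map_sum, map_smul, augmentation_smul, mul_comm]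
  refine Matrix.exists_vecMul_eq_zero_iff.1
    ⟨fun k => augmentation G V (p (Pi.single k 1)), fun hc => ?_, funext fun k => ?_⟩
  · obtain ⟨v⟩ := ‹Nonempty V›
    have h1 := hsum (i ((C0.equiv G V).symm (Finsupp.single v 1)))
    rw [hpi', Finset.sum_eq_zero fun k _ => by rw [show augmentation G V _ = 0 from
      congrFun hc k, zero_mul]] at h1
    simp [augmentation] at h1
  · have h1 := hpN (Pi.single k 1)
    rw [hsum] at h1
    exact h1

end Characters

end SerreGraph

/-! ### The class number type formula -/

theorem theorem6p2 {V E G : Type*} [Fintype V] [Fintype E] [CommGroup G] [Finite G]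
    [MulAction G V] [MulAction G E] (Y : SerreGraph V E) [Y.IsAction G]
    (hconn : Y.Connected) (hinv : Y.WithoutInversion G) (hfree : Y.FreeOnEdges G)
    (hχ : Y.eulerChar ≠ 0) :
    (∀ ψ : G →* ℂˣ, ψ ≠ 1 → (Y.h ψ).eval 1 ≠ 0) ∧
      (Y.h (1 : G →* ℂˣ)).rootMultiplicity 1 = 1 ∧
      -2 * (Y.eulerChar : ℂ) * (Y.numSpanningTrees : ℂ) =
        (Polynomial.derivative (Y.h (1 : G →* ℂˣ))).eval 1 *
          ∏ ψ ∈ SerreGraph.nontrivialCharacters G, (Y.h ψ).eval 1 := by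
  classical
  have hχ2 := Y.two_mul_eulerChar
  -- The empty graph counts as connected, but its Euler characteristic is `0`.
  have hV : Nonempty V := by
    by_contra hc
    rw [not_nonempty_iff] at hc
    have : IsEmpty E := ⟨fun e => hc.false (Y.o e)⟩
    simp at hχ2
    exact hχ hχ2
  have := Fintype.ofFinite (G →* ℂˣ)
  have hnt : SerreGraph.nontrivialCharacters G = Finset.univ.erase 1 := by
    ext ψ
    simp [SerreGraph.nontrivialCharacters]
  have h0 := Y.eval_h_one_one (G := G)
  have key : -2 * (Y.eulerChar : ℂ) * (Y.numSpanningTrees : ℂ) =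
      (Polynomial.derivative (Y.h (1 : G →* ℂˣ))).eval 1 *
        ∏ ψ ∈ SerreGraph.nontrivialCharacters G, (Y.h ψ).eval 1 := by
    have h1 := Y.eval_derivative_iharaPolynomial
    -- In the product rule at `1`, the term differentiating the other factors carries `h(1, ψ₀) =
    -- 0`.
    rw [← Y.prod_h (G := G), ← Finset.mul_prod_erase _ _ (Finset.mem_univ (1 : G →* ℂˣ)),
      Polynomial.derivative_mul, Polynomial.eval_add, Polynomial.eval_mul, Polynomial.eval_mul, h0,
      zero_mul, add_zero, Polynomial.eval_prod] at h1
    rw [hnt, h1]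
    have h2 : 2 * (Y.eulerChar : ℂ) = 2 * (Fintype.card V : ℂ) - (Fintype.card E : ℂ) := by
      exact_mod_cast hχ2
    rw [neg_mul, h2, neg_sub]
  have hne : -2 * (Y.eulerChar : ℂ) * (Y.numSpanningTrees : ℂ) ≠ 0 := by
    have := hconn.numSpanningTrees_ne_zero hV.some
    simp [hχ, this]
  rw [key] at hne
  have hder := left_ne_zero_of_mul hne
  refine ⟨fun ψ hψ => ?_, ?_, key⟩
  · exact Finset.prod_ne_zero_iff.1 (right_ne_zero_of_mul hne) ψ (by simp [hnt, hψ])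
  · have hp : Y.h (1 : G →* ℂˣ) ≠ 0 := by
      intro hc
      simp [hc] at hder
    refine le_antisymm ?_ ((Polynomial.rootMultiplicity_pos hp).2 h0)
    by_contra! hlt
    exact hder ((Polynomial.one_lt_rootMultiplicity_iff_isRoot hp).1 hlt).2
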